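/- Let $M$ be a connected, Hausdorff, second countable $C^\infty$ manifold without boundary of finite dimension, and let $p\colon V\to M$ be a $C^\infty$ real vector bundle of finite rank. An automorphism of $V$ is a $C^\infty$ diffeomorphism $\Phi\colon V\to V$ that permutes the fibres $V_x=p^{-1}(x)$ of $p$ and whose restriction to each fibre is linear. Let $\mathrm{AUT}\,V$ be the group of all automorphisms of $V$, let $\mathrm{Diff}\,M$ be the group of all $C^\infty$ diffeomorphisms of $M$, and let $h_V\colon\mathrm{AUT}\,V\to\mathrm{Diff}\,M$ be the map $\Phi\mapsto\varphi$, where $\varphi$ is the diffeomorphism of $M$ determined by $p\circ\Phi=\varphi\circ p$. A diffeomorphism $\varphi\in\mathrm{Diff}\,M$ can be lifted to an automorphism of $V$ if $\varphi=h_V(\Phi)$ for some $\Phi\in\mathrm{AUT}\,V$. (1) If $\varphi,\psi\in\mathrm{Diff}\,M$ are $C^0$ homotopic (that is, homotopic through continuous maps $M\to M$), then $\varphi$ can be lifted to an automorphism of $V$ if and only if $\psi$ can. (2) Hence, if every diffeomorphism of $M$ is $C^0$ homotopic to a diffeomorphism of $M$ that can be lifted to an automorphism of $V$, then $h_V\colon\mathrm{AUT}\,V\to\mathrm{Diff}\,M$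 is surjective. -/

import Mathlib

open Bundle
open scoped Manifold ContDiff

section VectorBundleAutomorphisms

variable {E : Type*} [NormedAddCommGroup E] [NormedSpace ℝ E]
  {H : Type*} [TopologicalSpace H] (I : ModelWithCorners ℝ E H)
  {M : Type*} [TopologicalSpace M] [ChartedSpace H M]
  (F : Type*) [NormedAddCommGroup F] [NormedSpace ℝ F]
  (V : M → Type*) [∀ x, AddCommGroup (V x)] [∀ x, Module ℝ (V x)]
  [∀ x, TopologicalSpace (V x)] [TopologicalSpace (TotalSpace F V)] [FiberBundle F V]

/-- An automorphism of the real vector bundle `V → M` (an element of `AUT V`): a smooth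
diffeomorphism of the total space that carries every fibre `V x` onto a fibre `V y`
by a linear isomorphism. The base map `x ↦ y` is not required to be the identity. -/
structure VectorBundleAut where
  /-- The underlying diffeomorphism of the total space. -/
  toDiffeomorph : TotalSpace F V ≃ₘ^∞⟮I.prod 𝓘(ℝ, F), I.prod 𝓘(ℝ, F)⟯ TotalSpace F V
  /-- Fibres go to fibres, linearly. -/
  exists_linearEquiv : ∀ x : M, ∃ (y : M) (L : V x ≃ₗ[ℝ] V y),
    ∀ v : V x, toDiffeomorph ⟨x, v⟩ = ⟨y, L v⟩

namespace VectorBundleAut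

variable {I F V}

/-- The fibre over `x` is carried into the fibre over the projection of the image of `0 : V x`. -/
theorem proj_apply (Φ : VectorBundleAut I F V) (p : TotalSpace F V) :
    (Φ.toDiffeomorph p).proj = (Φ.toDiffeomorph ⟨p.proj, 0⟩).proj := by
  obtain ⟨x, v⟩ := p
  obtain ⟨y, L, hL⟩ := Φ.exists_linearEquiv x
  simp only [hL]

theorem symm_zero (Φ : VectorBundleAut I F V) (x : M) :
    Φ.toDiffeomorph.symm ⟨(Φ.toDiffeomorph ⟨x, 0⟩).proj, 0⟩ = ⟨x, 0⟩ := by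
  obtain ⟨y, L, hL⟩ := Φ.exists_linearEquiv x
  have h : Φ.toDiffeomorph ⟨x, 0⟩ = ⟨y, 0⟩ := by rw [hL, map_zero]
  rw [h]
  change Φ.toDiffeomorph.symm ⟨y, 0⟩ = ⟨x, 0⟩
  rw [← h, Diffeomorph.symm_apply_apply]

variable [VectorBundle ℝ F V]

/-- The map `h_V : AUT V → Diff M`: the diffeomorphism `φ` of the base induced by a vector bundle
automorphism `Φ`, where `φ x` is the point whose fibre is the image under `Φ` of the fibre
over `x`. -/
noncomputable def hV (Φ : VectorBundleAut I F V) : M ≃ₘ^∞⟮I, I⟯ M where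
  toFun x := (Φ.toDiffeomorph ⟨x, 0⟩).proj
  invFun y := (Φ.toDiffeomorph.symm ⟨y, 0⟩).proj
  left_inv x := by
    change (Φ.toDiffeomorph.symm ⟨(Φ.toDiffeomorph ⟨x, 0⟩).proj, 0⟩).proj = x
    rw [symm_zero]
  right_inv y := by
    change (Φ.toDiffeomorph ⟨(Φ.toDiffeomorph.symm ⟨y, 0⟩).proj, 0⟩).proj = y
    rw [← proj_apply, Diffeomorph.apply_symm_apply]
  contMDiff_toFun :=
    (contMDiff_proj V).comp (Φ.toDiffeomorph.contMDiff.comp (contMDiff_zeroSection ℝ V))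
  contMDiff_invFun :=
    (contMDiff_proj V).comp (Φ.toDiffeomorph.symm.contMDiff.comp (contMDiff_zeroSection ℝ V))

/-- `p ∘ Φ = h_V(Φ) ∘ p`. -/
theorem proj_toDiffeomorph (Φ : VectorBundleAut I F V) (p : TotalSpace F V) :
    (Φ.toDiffeomorph p).proj = Φ.hV p.proj :=
  Φ.proj_apply p

end VectorBundleAut

/-- A diffeomorphism `φ` of `M` can be lifted to an automorphism of `V`. -/
def CanBeLifted [VectorBundle ℝ F V]
    (φ : M ≃ₘ^∞⟮I, I⟯ M) : Prop :=
  ∃ Φ : VectorBundleAut I F V, Φ.hV = φ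

/-- Two diffeomorphisms of `M` are `C⁰` homotopic: they are homotopic as continuous maps. -/
def Diffeomorph.C0Homotopic {I : ModelWithCorners ℝ E H} (φ ψ : M ≃ₘ^∞⟮I, I⟯ M) : Prop :=
  ContinuousMap.Homotopic (⟨φ, φ.continuous⟩ : C(M, M)) ⟨ψ, ψ.continuous⟩

end VectorBundleAutomorphisms

/-! A lift of `φ` is a smooth family of isomorphisms `V x → V (φ x)`. A homotopy from `φ` to `ψ`
moves the target fibre, and the family is carried along in three stages. Transport: a partition of
unity averages local identifications into maps `A x y : V x → V y`, injective near the diagonal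
(`exists_transport`). Composing them along a fine subdivision of the homotopy gives a continuous
injective family over `ψ` (`IsContinuousInjectiveOver.of_homotopy`). As `M` may be noncompact, the
step length is a positive continuous function on `M`. Smoothing: near each point the family is close
to one with constant matrix. Averaging these smooth models keeps the error below the size of the
vector's image, so injectivity survives (`IsContinuousInjectiveOver.exists_contMDiff`). Inversion:
fibres have equal finite dimension, so injective maps are bijective, and matrix inversion is smooth
(`contMDiff_of_rightInverse`). Hence only injectivity is tracked before this stage. -/

section LiftingDiffeomorphisms

open Filter Topology Set

variable {E : Type*} [NormedAddCommGroup E] [NormedSpace ℝ E]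
  {H : Type*} [TopologicalSpace H] {I : ModelWithCorners ℝ E H}
  {M : Type*} [TopologicalSpace M] [ChartedSpace H M]
  {F : Type*} [NormedAddCommGroup F] [NormedSpace ℝ F]
  {V : M → Type*} [∀ x, AddCommGroup (V x)] [∀ x, Module ℝ (V x)]
  [∀ x, TopologicalSpace (V x)] [TopologicalSpace (TotalSpace F V)] [FiberBundle F V]
  [VectorBundle ℝ F V]

/-! ### Conditions on nonzero vectors of a fibre -/

/-- The zero section of a vector bundle is closed: vectors near a nonzero vector are nonzero. -/
theorem eventually_snd_ne_zero {v : TotalSpace F V} (hv : v.2 ≠ 0) :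
    ∀ᶠ w in 𝓝 v, w.2 ≠ 0 := by
  set e := trivializationAt F V v.proj
  have hvs : v ∈ e.source := FiberBundle.mem_trivializationAt_proj_source
  have hvb : v.proj ∈ e.baseSet := e.mem_source.1 hvs
  have key : ∀ w : TotalSpace F V, w.proj ∈ e.baseSet → ((e w).2 ≠ 0 ↔ w.2 ≠ 0) := by
    rintro ⟨x, w⟩ hw
    have := (e.linearEquivAt ℝ x hw).map_eq_zero_iff (x := w)
    rw [Trivialization.linearEquivAt_apply] at this
    exact this.not
  have hc : ContinuousAt (fun w ↦ (e w).2) v := (e.continuousAt hvs).snd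
  filter_upwards [hc.eventually_ne ((key v hvb).2 hv),
    e.open_source.mem_nhds hvs] with w hw hws
  exact (key w (e.mem_source.1 hws)).1 hw

/-- The map `(x, u) ↦ e⁻¹ (x, u)` given by a local trivialization is continuous. -/
theorem Bundle.Trivialization.continuousAt_mk_symmₗ (e : Trivialization F (π F V))
    [MemTrivializationAtlas e] {x₀ : M} (hx₀ : x₀ ∈ e.baseSet) (u₀ : F) :
    ContinuousAt (fun z : M × F ↦ (⟨z.1, e.symmₗ ℝ z.1 z.2⟩ : TotalSpace F V)) (x₀, u₀) := by
  have ht : (x₀, u₀) ∈ e.toOpenPartialHomeomorph.target := e.mem_target.2 hx₀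
  refine (e.toOpenPartialHomeomorph.symm.continuousAt ht).congr ?_
  filter_upwards [e.open_target.mem_nhds ht] with z hz
  rw [← e.mk_symm (e.mem_target.1 hz), e.symmₗ_apply (e.mem_target.1 hz)]

/-- A scaling-invariant condition which is open at the nonzero vectors of one fibre holds for the
nonzero vectors of all neighbouring fibres. -/
theorem eventually_forall_ne_zero [FiniteDimensional ℝ F] {Y : Type*} [TopologicalSpace Y]
    {x₀ : M} {y₀ : Y} {Q : TotalSpace F V → Y → Prop}
    (hQ : ∀ (x : M) (v : V x) (y : Y) (c : ℝ), c ≠ 0 → Q ⟨x, c • v⟩ y → Q ⟨x, v⟩ y)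
    (h : ∀ v : V x₀, v ≠ 0 →
      ∀ᶠ z in 𝓝 ((⟨x₀, v⟩, y₀) : TotalSpace F V × Y), Q z.1 z.2) :
    ∀ᶠ z in 𝓝 (x₀, y₀), ∀ v : V z.1, v ≠ 0 → Q ⟨z.1, v⟩ z.2 := by
  set e := trivializationAt F V x₀
  have hx₀ : x₀ ∈ e.baseSet := FiberBundle.mem_baseSet_trivializationAt' x₀
  -- The unit sphere of `F` is compact, so a single neighbourhood serves all directions; scaling
  -- then reaches every nonzero vector.
  have hK : ∀ᶠ z in 𝓝 (x₀, y₀), ∀ u ∈ Metric.sphere (0 : F) 1,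
      Q ⟨z.1, e.symmₗ ℝ z.1 u⟩ z.2 := by
    refine (isCompact_sphere (0 : F) 1).eventually_forall_of_forall_eventually fun u hu ↦ ?_
    have hu0 : e.symmₗ ℝ x₀ u ≠ 0 := by
      intro h0
      have := e.linearMapAt_symmₗ (R := ℝ) hx₀ u
      rw [h0, map_zero] at this
      simp [← this] at hu
    have hc : ContinuousAt (fun z : (M × Y) × F ↦
        ((⟨z.1.1, e.symmₗ ℝ z.1.1 z.2⟩, z.1.2) : TotalSpace F V × Y)) ((x₀, y₀), u) := by
      refine ContinuousAt.prodMk ?_ (by fun_prop)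
      exact ContinuousAt.comp (f := fun z : (M × Y) × F ↦ (z.1.1, z.2)) (x := ((x₀, y₀), u))
        (e.continuousAt_mk_symmₗ hx₀ u) (by fun_prop)
    exact hc.eventually (h _ hu0)
  have hb : ∀ᶠ z : M × Y in 𝓝 (x₀, y₀), z.1 ∈ e.baseSet :=
    continuousAt_fst.eventually (e.open_baseSet.mem_nhds hx₀)
  filter_upwards [hK, hb] with ⟨x, y⟩ hz hx v hv
  have hu : e.linearMapAt ℝ x v ≠ 0 := by
    intro h0
    have := e.symmₗ_linearMapAt (R := ℝ) hx v
    rw [h0, map_zero] at this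
    exact hv this.symm
  refine hQ x v y ‖e.linearMapAt ℝ x v‖⁻¹ (inv_ne_zero (norm_ne_zero_iff.2 hu)) ?_
  have := hz (‖e.linearMapAt ℝ x v‖⁻¹ • e.linearMapAt ℝ x v)
    (by simp [norm_smul, norm_ne_zero_iff.2 hu])
  rwa [map_smul, e.symmₗ_linearMapAt hx] at this

/-! ### Patching linear maps and transport near the diagonal -/

/-- The linear map `V x → V y` obtained by patching together, with weights a partition of unity
evaluated at `x`, the maps with matrix `c i` in the trivializations at `i` and at `b i`. -/
noncomputable def linearPatch (f : SmoothPartitionOfUnity M I M) (b : M → M)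
    (c : M → F →L[ℝ] F) (x y : M) : V x →ₗ[ℝ] V y :=
  ∑ i ∈ f.finsupport x, f i x • ((trivializationAt F V (b i)).symmₗ ℝ y ∘ₗ (c i : F →ₗ[ℝ] F) ∘ₗ
    (trivializationAt F V i).linearMapAt ℝ x)

/-- Allowing a larger index set makes the sum range over a fixed finite set as `x` varies locally.
-/
theorem linearPatch_apply {f : SmoothPartitionOfUnity M I M} {b : M → M}
    {c : M → F →L[ℝ] F} {x y : M} {s : Finset M} (hs : f.finsupport x ⊆ s) (v : V x) :
    (linearPatch f b c x y : V x →ₗ[ℝ] V y) v =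
      ∑ i ∈ s, f i x • (trivializationAt F V (b i)).symmₗ ℝ y
        (c i ((trivializationAt F V i).linearMapAt ℝ x v)) := by
  rw [linearPatch, LinearMap.sum_apply]
  refine Finset.sum_subset hs fun i _ hi ↦ ?_
  have : f i x = 0 := by simpa using hi
  simp [this]

/-- Near `n₀` only the finitely many indices in `fintsupport` contribute, and each term reads in
coordinates as a coordinate change after a constant matrix. The parameter space `N` is free so that
`Y` may vary independently of `P` (transport) or be determined by it (smoothing). -/
theorem contMDiffAt_linearPatch [ContMDiffVectorBundle ∞ F V I]
    {E' : Type*} [NormedAddCommGroup E'] [NormedSpace ℝ E'] {H' : Type*} [TopologicalSpace H']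
    {J : ModelWithCorners ℝ E' H'} {N : Type*} [TopologicalSpace N] [ChartedSpace H' N]
    {f : SmoothPartitionOfUnity M I M} {b : M → M} {c : M → F →L[ℝ] F}
    {P : N → TotalSpace F V} {Y : N → M} {n₀ : N}
    (hP : ContMDiffAt J (I.prod 𝓘(ℝ, F)) ∞ P n₀) (hY : ContMDiffAt J I ∞ Y n₀)
    (h : ∀ i, (P n₀).proj ∈ tsupport (f i) →
      (P n₀).proj ∈ (trivializationAt F V i).baseSet ∧
        Y n₀ ∈ (trivializationAt F V (b i)).baseSet) :
    ContMDiffAt J (I.prod 𝓘(ℝ, F)) ∞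
      (fun n ↦ (⟨Y n, linearPatch f b c (P n).proj (Y n) (P n).2⟩ : TotalSpace F V)) n₀ := by
  have hp : ContMDiffAt J I ∞ (fun n ↦ (P n).proj) n₀ := (contMDiffAt_totalSpace.1 hP).1
  set e := trivializationAt F V (Y n₀)
  have hY₀ : Y n₀ ∈ e.baseSet := FiberBundle.mem_baseSet_trivializationAt' _
  rw [contMDiffAt_totalSpace]
  refine ⟨hY, ?_⟩
  have hsum : ContMDiffAt J 𝓘(ℝ, F) ∞ (fun n ↦ ∑ i ∈ f.fintsupport (P n₀).proj,
      f i (P n).proj • (trivializationAt F V (b i)).coordChange e (Y n)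
        (c i ((trivializationAt F V i) (P n)).2)) n₀ := by
    refine ContMDiffAt.sum fun i hi ↦ ?_
    obtain ⟨h1, h2⟩ := h i ((f.mem_fintsupport_iff _ i).1 hi)
    refine ContMDiffAt.smul ((f i).contMDiff.contMDiffAt.comp n₀ hp) ?_
    refine ContMDiffAt.coordChange hY ?_ h2 hY₀
    exact (c i).contMDiff.contMDiffAt.comp n₀
      (((trivializationAt F V i).contMDiffAt_iff
        ((trivializationAt F V i).mem_source.2 h1)).1 hP).2
  refine hsum.congr_of_eventuallyEq ?_
  have hev : ∀ᶠ n in 𝓝 n₀, ∀ i ∈ f.fintsupport (P n₀).proj,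
      (P n).proj ∈ (trivializationAt F V i).baseSet ∧
        Y n ∈ (trivializationAt F V (b i)).baseSet := by
    refine (Filter.eventually_all_finset _).2 fun i hi ↦ ?_
    obtain ⟨h1, h2⟩ := h i ((f.mem_fintsupport_iff _ i).1 hi)
    exact (hp.continuousAt.eventually ((trivializationAt F V i).open_baseSet.mem_nhds h1)).and
      (hY.continuousAt.eventually ((trivializationAt F V (b i)).open_baseSet.mem_nhds h2))
  filter_upwards [hev, hp.continuousAt.eventually (f.eventually_finsupport_subset _),
    hY.continuousAt.eventually (e.open_baseSet.mem_nhds hY₀)] with n hn hns hne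
  have h3 : (e ⟨Y n, linearPatch f b c (P n).proj (Y n) (P n).2⟩).2 =
      e.linearMapAt ℝ (Y n) (linearPatch f b c (P n).proj (Y n) (P n).2) := by
    rw [e.coe_linearMapAt_of_mem hne]
  change (e ⟨Y n, linearPatch f b c (P n).proj (Y n) (P n).2⟩).2 = _
  rw [h3, linearPatch_apply hns, map_sum]
  refine Finset.sum_congr rfl fun i hi ↦ ?_
  obtain ⟨h1, h2⟩ := hn i hi
  rw [map_smul, Trivialization.symmₗ_apply _ h2, e.coe_linearMapAt_of_mem hne,
    Trivialization.coe_linearMapAt_of_mem _ h1, Trivialization.coordChange,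
    ← Trivialization.mk_symm _ h2]

variable (I F V) in
/-- There are linear maps `A x y : V x → V y`, equal to the identity on the diagonal, which are
injective and depend continuously on `(x, y)` near the diagonal. -/
theorem exists_transport [FiniteDimensional ℝ E] [IsManifold I ∞ M] [T2Space M]
    [SigmaCompactSpace M] [FiniteDimensional ℝ F] [ContMDiffVectorBundle ∞ F V I] :
    ∃ (A : ∀ x y, V x →ₗ[ℝ] V y) (P : M × M → Prop), (∀ x v, A x x v = v) ∧
      (∀ x, ∀ᶠ z in 𝓝 (x, x), P z) ∧ ∀ z, P z → Function.Injective (A z.1 z.2) ∧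
        ∀ v : V z.1, ContinuousAt (fun q : TotalSpace F V × M ↦
          (⟨q.2, A q.1.proj q.2 q.1.2⟩ : TotalSpace F V)) (⟨z.1, v⟩, z.2) := by
  obtain ⟨f, hf⟩ := SmoothPartitionOfUnity.exists_isSubordinate I isClosed_univ
    (fun i : M ↦ (trivializationAt F V i).baseSet)
    (fun i ↦ (trivializationAt F V i).open_baseSet)
    (fun x _ ↦ mem_iUnion.2 ⟨x, FiberBundle.mem_baseSet_trivializationAt' x⟩)
  let A : ∀ x y, V x →ₗ[ℝ] V y := fun x y ↦
    linearPatch f id (fun _ ↦ ContinuousLinearMap.id ℝ F) x y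
  -- `symmₗ` is zero off its base set, so the patch is only controlled where every contributing
  -- trivialization also covers the second point.
  let S : M × M → Prop := fun z ↦ ∀ i, z.1 ∈ tsupport (f i) →
    z.2 ∈ (trivializationAt F V i).baseSet
  have hdiag : ∀ x v, A x x v = v := by
    intro x v
    change linearPatch f id (fun _ ↦ ContinuousLinearMap.id ℝ F) x x v = v
    rw [linearPatch_apply subset_rfl]
    have : ∀ i ∈ f.finsupport x, f i x • (trivializationAt F V (id i)).symmₗ ℝ x
        (ContinuousLinearMap.id ℝ F ((trivializationAt F V i).linearMapAt ℝ x v)) =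
        f i x • v := by
      intro i hi
      have hx := hf i ((f.mem_fintsupport_iff x i).1 (f.finsupport_subset_fintsupport x hi))
      simp only [id, ContinuousLinearMap.coe_id']
      rw [Trivialization.symmₗ_linearMapAt _ hx]
    rw [Finset.sum_congr rfl this, ← Finset.sum_smul, f.sum_finsupport x (mem_univ x), one_smul]
  have hS : ∀ x, ∀ᶠ z in 𝓝 (x, x), S z := by
    intro x
    have h1 : ∀ᶠ z : M × M in 𝓝 (x, x), ∀ i ∈ f.fintsupport x,
        z.2 ∈ (trivializationAt F V i).baseSet :=
      (Filter.eventually_all_finset _).2 fun i hi ↦ continuousAt_snd.eventually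
        ((trivializationAt F V i).open_baseSet.mem_nhds (hf i ((f.mem_fintsupport_iff x i).1 hi)))
    have h2 : ∀ᶠ z : M × M in 𝓝 (x, x), f.fintsupport z.1 ⊆ f.fintsupport x :=
      continuousAt_fst.eventually
        (p := fun a ↦ f.fintsupport a ⊆ f.fintsupport x) (f.eventually_fintsupport_subset x)
    filter_upwards [h1, h2] with z hz1 hz2 i hi
    exact hz1 i (hz2 ((f.mem_fintsupport_iff z.1 i).2 hi))
  have hcont : ∀ z, S z → ∀ v : V z.1, ContinuousAt (fun q : TotalSpace F V × M ↦
      (⟨q.2, A q.1.proj q.2 q.1.2⟩ : TotalSpace F V)) (⟨z.1, v⟩, z.2) := by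
    intro z hz v
    exact (contMDiffAt_linearPatch (J := (I.prod 𝓘(ℝ, F)).prod I) contMDiffAt_fst contMDiffAt_snd
      fun i hi ↦ ⟨hf i hi, hz i hi⟩).continuousAt
  refine ⟨A, fun z ↦ S z ∧ Function.Injective (A z.1 z.2), hdiag, fun x ↦ (hS x).and ?_,
    fun z hz ↦ ⟨hz.2, hcont z hz.1⟩⟩
  -- Injectivity is an open condition, and it holds on the diagonal, where `A x x` is the identity.
  have := eventually_forall_ne_zero (F := F) (V := V) (x₀ := x) (y₀ := x)
    (Q := fun p y ↦ A p.proj y p.2 ≠ 0) (fun a v y c hc h h0 ↦ h (by simp [h0])) ?_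
  · filter_upwards [this] with z hz
    refine (injective_iff_map_eq_zero _).2 fun v hv ↦ ?_
    by_contra hv0
    exact hz v hv0 hv
  · intro v hv
    refine (hcont (x, x) (hS x).self_of_nhds v).eventually (eventually_snd_ne_zero ?_)
    change A x x v ≠ 0
    rwa [hdiag]

/-! ### Deformation along a homotopy -/

variable (F) in
/-- A family of injective linear maps `V x → V (b x)` that is continuous on the total space. -/
def IsContinuousInjectiveOver {b : M → M} (τ : ∀ x, V x →ₗ[ℝ] V (b x)) : Prop :=
  (∀ x, Function.Injective (τ x)) ∧
    Continuous fun p : TotalSpace F V ↦ (⟨b p.proj, τ p.proj p.2⟩ : TotalSpace F V)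

/-- Given an open neighbourhood of the diagonal, a homotopy can be subdivided into steps inside
this neighbourhood, whose length is locally constant. -/
theorem exists_pos_forall_dist_le {X Y : Type*} [TopologicalSpace X] [TopologicalSpace Y]
    {h : unitInterval × X → Y} (hh : Continuous h) {P : Y × Y → Prop}
    (hP : ∀ y, ∀ᶠ z in 𝓝 (y, y), P z) (x₀ : X) :
    ∃ ε : ℝ, 0 < ε ∧ ∀ᶠ x in 𝓝 x₀, ∀ s t : unitInterval, dist s t ≤ ε → P (h (s, x), h (t, x)) := by
  -- The step bound is treated as a real variable near `0`, so that compactness of the interval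
  -- makes it uniform in `s`.
  have key : ∀ᶠ z in 𝓝 ((0 : ℝ), x₀), ∀ s ∈ (univ : Set unitInterval),
      ∀ t, dist s t ≤ z.1 → P (h (s, z.2), h (t, z.2)) := by
    refine isCompact_univ.eventually_forall_of_forall_eventually fun s _ ↦ ?_
    have hc : Continuous fun z : (unitInterval × unitInterval) × X ↦
        (h (z.1.1, z.2), h (z.1.2, z.2)) := by fun_prop
    have h1 := (hc.continuousAt (x := ((s, s), x₀))).eventually (hP (h (s, x₀)))
    rw [nhds_prod_eq, nhds_prod_eq, ((Metric.nhds_basis_ball.prod_self).prod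
      (𝓝 x₀).basis_sets).eventually_iff] at h1
    obtain ⟨⟨δ, U⟩, ⟨hδ, hU⟩, hδU⟩ := h1
    have h2 : ∀ᶠ z : (ℝ × X) × unitInterval in 𝓝 ((0, x₀), s),
        z.1.1 < δ / 2 ∧ z.1.2 ∈ U ∧ dist z.2 s < δ / 2 := by
      refine ((Continuous.continuousAt (by fun_prop)).eventually_lt continuousAt_const
        (by simpa using half_pos hδ)).and (.and ?_ ?_)
      · exact (continuousAt_snd.comp continuousAt_fst).eventually
          (p := fun a ↦ a ∈ U) hU
      · exact (Continuous.continuousAt (by fun_prop)).eventually_lt continuousAt_const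
          (by simpa using half_pos hδ)
    filter_upwards [h2] with ⟨⟨ε, x⟩, s'⟩ ⟨hz1, hz2, hz3⟩ t ht
    refine hδU (x := ((s', t), x)) ⟨⟨?_, ?_⟩, hz2⟩
    · exact Metric.mem_ball.2 (by simp only at hz3 ⊢; linarith)
    · refine Metric.mem_ball.2 ((dist_triangle t s' s).trans_lt ?_)
      rw [dist_comm t s']
      simp only at ht hz1 hz3
      linarith
  rw [nhds_prod_eq] at key
  obtain ⟨δ, hδ, hball⟩ := Metric.eventually_nhds_iff.1 key.curry
  refine ⟨δ / 2, half_pos hδ, ?_⟩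
  have hlt : dist (δ / 2) 0 < δ := by
    rw [Real.dist_eq, sub_zero, abs_of_pos (half_pos hδ)]; linarith
  filter_upwards [hball hlt] with x hx s t hst
  exact hx s (mem_univ s) t hst

/-- A family of injective linear maps over `φ` deforms along a homotopy from `φ` to `ψ`. -/
theorem IsContinuousInjectiveOver.of_homotopy [FiniteDimensional ℝ E] [IsManifold I ∞ M]
    [T2Space M] [SigmaCompactSpace M] [FiniteDimensional ℝ F] [ContMDiffVectorBundle ∞ F V I]
    {φ ψ : C(M, M)} (h : φ.Homotopy ψ) {τ : ∀ x, V x →ₗ[ℝ] V (φ x)}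
    (hτ : IsContinuousInjectiveOver F τ) :
    ∃ σ : ∀ x, V x →ₗ[ℝ] V (ψ x), IsContinuousInjectiveOver F σ := by
  obtain ⟨A, P, hA, hP, hAP⟩ := exists_transport I F V
  have : LocallyCompactSpace H := I.locallyCompactSpace
  have : LocallyCompactSpace M := ChartedSpace.locallyCompactSpace H M
  have step : ∀ {b b' : M → M} {τ : ∀ x, V x →ₗ[ℝ] V (b x)}, Continuous b' →
      (∀ x, P (b x, b' x)) → IsContinuousInjectiveOver F τ →
      IsContinuousInjectiveOver F (fun x ↦ A (b x) (b' x) ∘ₗ τ x) := by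
    intro b b' τ hb' hbP hτ
    refine ⟨fun x ↦ (hAP _ (hbP x)).1.comp (hτ.1 x), continuous_iff_continuousAt.2 fun p ↦ ?_⟩
    exact ContinuousAt.comp (f := fun p : TotalSpace F V ↦
        (((⟨b p.proj, τ p.proj p.2⟩ : TotalSpace F V), b' p.proj) : TotalSpace F V × M)) (x := p)
      ((hAP _ (hbP p.proj)).2 (τ p.proj p.2))
      (hτ.2.prodMk (hb'.comp (FiberBundle.continuous_proj F V))).continuousAt
  -- Admissible step lengths at a point form an interval, hence a convex set, so local constant
  -- choices glue to a continuous `ε`.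
  obtain ⟨ε, hε⟩ := exists_continuous_forall_mem_convex_of_local_const
    (t := fun x : M ↦ {ε : ℝ | 0 < ε ∧ ∀ s t : unitInterval, dist s t ≤ ε →
      P (h (s, x), h (t, x))})
    (fun x ↦ OrdConnected.convex ⟨fun a ha b hb c hc ↦
      ⟨ha.1.trans_le hc.1, fun s t hst ↦ hb.2 s t (hst.trans hc.2)⟩⟩)
    (fun x ↦ by
      obtain ⟨ε, hε, hx⟩ := exists_pos_forall_dist_le h.continuous hP x
      exact ⟨ε, hx.mono fun y hy ↦ ⟨hε, hy⟩⟩)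
  let t : ℕ → M → unitInterval := fun k x ↦ projIcc 0 1 zero_le_one (k * ε x)
  let b : ℕ → M → M := fun k x ↦ h (t k x, x)
  have ht : ∀ k, Continuous (t k) := fun k ↦ continuous_projIcc.comp (by fun_prop)
  have hb : ∀ k, Continuous (b k) := fun k ↦ h.continuous.comp ((ht k).prodMk continuous_id)
  have hb0 : ∀ x, b 0 x = φ x := fun x ↦ by simp [b, t]
  have ht1 : ∀ (k : ℕ) (x : M), 1 ≤ k * ε x → t k x = 1 := fun k x hk ↦ projIcc_of_right_le zero_le_one hk
  have hbP : ∀ k x, P (b k x, b (k + 1) x) := by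
    intro k x
    refine (hε x).2 _ _ ?_
    have h1 := (LipschitzWith.projIcc (zero_le_one (α := ℝ))).dist_le_mul
      (k * ε x) ((k + 1 : ℕ) * ε x)
    refine h1.trans ?_
    rw [Real.dist_eq, NNReal.coe_one, one_mul, abs_sub_comm]
    push_cast
    rw [show ((k : ℝ) + 1) * ε x - k * ε x = ε x by ring, abs_of_pos (hε x).1]
  -- The initial factor `A (φ x) (b 0 x)` is the identity in disguise: it bridges the propositional
  -- equality `b 0 x = φ x`.
  let T : ∀ (k : ℕ) (x : M), V x →ₗ[ℝ] V (b k x) := fun k ↦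
    Nat.rec (motive := fun k ↦ ∀ x, V x →ₗ[ℝ] V (b k x))
      (fun x ↦ A (φ x) (b 0 x) ∘ₗ τ x) (fun k T x ↦ A (b k x) (b (k + 1) x) ∘ₗ T x) k
  have hT : ∀ k, IsContinuousInjectiveOver F (T k) := by
    intro k
    induction k with
    | zero =>
      exact step (hb 0) (fun x ↦ by rw [hb0]; exact (hP (φ x)).self_of_nhds) hτ
    | succ k ih => exact step (hb (k + 1)) (hbP k) ih
  let N : M → ℕ := fun x ↦ ⌈(ε x)⁻¹⌉₊
  have hN : ∀ k x, N x ≤ k → t k x = 1 := by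
    intro k x hk
    refine ht1 k x ?_
    have h1 : (ε x)⁻¹ ≤ k := (Nat.le_ceil _).trans (by exact_mod_cast hk)
    calc (1 : ℝ) = (ε x)⁻¹ * ε x := (inv_mul_cancel₀ (hε x).1.ne').symm
      _ ≤ k * ε x := mul_le_mul_of_nonneg_right h1 (hε x).1.le
  have hAeq : ∀ {y y' : M} (_ : y = y') (z : M) (v : V y), A y' z (A y y' v) = A y z v := by
    rintro y _ rfl z v
    rw [hA]
  -- `N` is not continuous, but once time `1` is reached further steps are identities, so any larger
  -- step count gives the same map.
  have hbN : ∀ k x, N x ≤ k → b k x = ψ x := fun k x hk ↦ by simp [b, hN k x hk]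
  have hstab : ∀ x k, N x ≤ k → ∀ v : V x,
      A (b k x) (ψ x) (T k x v) = A (b (N x) x) (ψ x) (T (N x) x v) := by
    intro x k hk v
    induction k, hk using Nat.le_induction with
    | base => rfl
    | succ k hk ih =>
      rw [← ih]
      exact hAeq ((hbN k x hk).trans (hbN (k + 1) x (hk.trans k.le_succ)).symm) _ _
  refine ⟨fun x ↦ A (b (N x) x) (ψ x) ∘ₗ T (N x) x, fun x ↦ ?_, ?_⟩
  · have : P (b (N x) x, ψ x) := by
      rw [hbN _ _ le_rfl]; exact (hP (ψ x)).self_of_nhds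
    exact (hAP _ this).1.comp ((hT (N x)).1 x)
  · refine continuous_iff_continuousAt.2 fun p ↦ ?_
    -- The `+ 1` leaves room for `(ε x)⁻¹` to vary, so the constant `K` bounds `N` on a
    -- neighbourhood.
    let K : ℕ := ⌈(ε p.proj)⁻¹ + 1⌉₊
    have hK : ∀ᶠ x in 𝓝 p.proj, N x ≤ K := by
      have hc : ContinuousAt (fun x ↦ (ε x)⁻¹) p.proj :=
        ε.continuous.continuousAt.inv₀ (hε _).1.ne'
      filter_upwards [hc.eventually_lt continuousAt_const (lt_add_one (ε p.proj)⁻¹)] with x hx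
      exact Nat.ceil_mono hx.le
    have hKp : P (b K p.proj, ψ p.proj) := by
      rw [hbN _ _ hK.self_of_nhds]; exact (hP _).self_of_nhds
    have hc : ContinuousAt (fun p : TotalSpace F V ↦
        (⟨ψ p.proj, A (b K p.proj) (ψ p.proj) (T K p.proj p.2)⟩ : TotalSpace F V)) p :=
      ContinuousAt.comp (f := fun p : TotalSpace F V ↦
          (((⟨b K p.proj, T K p.proj p.2⟩ : TotalSpace F V), ψ p.proj) : TotalSpace F V × M))
        (x := p) ((hAP _ hKp).2 (T K p.proj p.2))
        ((hT K).2.prodMk (ψ.continuous.comp (FiberBundle.continuous_proj F V))).continuousAt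
    refine hc.congr ?_
    filter_upwards [(FiberBundle.continuous_proj F V).continuousAt.eventually hK] with q hq
    exact congrArg (TotalSpace.mk (ψ q.proj)) (hstab q.proj K hq q.2)

/-! ### Smoothing a continuous family -/

/-- The seminorm on the fibre `V y` obtained by averaging the norms of the coordinates of a vector
with respect to a partition of unity. -/
noncomputable def fiberSeminorm (f : SmoothPartitionOfUnity M I M) (y : M) : Seminorm ℝ (V y) :=
  ∑ i ∈ f.finsupport y, Real.toNNReal (f i y) •
    (normSeminorm ℝ F).comp ((trivializationAt F V i).linearMapAt ℝ y)

theorem fiberSeminorm_apply {f : SmoothPartitionOfUnity M I M} {y : M} {s : Finset M}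
    (hs : f.finsupport y ⊆ s) (v : V y) : fiberSeminorm (F := F) f y v =
      ∑ i ∈ s, f i y * ‖(trivializationAt F V i).linearMapAt ℝ y v‖ := by
  have h1 : fiberSeminorm (F := F) f y v = ∑ i ∈ f.finsupport y,
      f i y * ‖(trivializationAt F V i).linearMapAt ℝ y v‖ := by
    change FunLike.coeAddMonoidHom (Seminorm ℝ (V y)) (V y) ℝ (fiberSeminorm (F := F) f y) v = _
    rw [fiberSeminorm, map_sum, Finset.sum_apply]
    refine Finset.sum_congr rfl fun i _ ↦ ?_
    change (Real.toNNReal (f i y) • (normSeminorm ℝ F).comp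
      ((trivializationAt F V i).linearMapAt ℝ y)) v = _
    rw [smul_apply, Seminorm.comp_apply, coe_normSeminorm, NNReal.smul_def,
      Real.coe_toNNReal _ (f.nonneg i y), smul_eq_mul]
  rw [h1]
  refine Finset.sum_subset hs fun i _ hi ↦ ?_
  have : f i y = 0 := by simpa using hi
  simp [this]

theorem fiberSeminorm_pos {f : SmoothPartitionOfUnity M I M}
    (hf : f.IsSubordinate fun i ↦ (trivializationAt F V i).baseSet) {y : M} {v : V y}
    (hv : v ≠ 0) : 0 < fiberSeminorm (F := F) f y v := by
  rw [fiberSeminorm_apply subset_rfl]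
  obtain ⟨i, hi⟩ := f.exists_pos_of_mem (mem_univ y)
  have hy : y ∈ (trivializationAt F V i).baseSet := hf i (subset_closure hi.ne')
  refine Finset.sum_pos' (fun i _ ↦ mul_nonneg (f.nonneg i y) (norm_nonneg _))
    ⟨i, (f.mem_finsupport y).2 hi.ne', mul_pos hi (norm_pos_iff.2 fun h0 ↦ hv ?_)⟩
  rw [← (trivializationAt F V i).symmₗ_linearMapAt (R := ℝ) hy v, h0, map_zero]

/-- Subtraction is done in each trivialization, where the fibres become the fixed space `F`. Taking
`t = 0` gives continuity of the seminorm itself. -/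
theorem continuousAt_fiberSeminorm_sub {f : SmoothPartitionOfUnity M I M}
    (hf : f.IsSubordinate fun i ↦ (trivializationAt F V i).baseSet)
    {N : Type*} [TopologicalSpace N] {b : N → M} {s t : ∀ n, V (b n)} {n₀ : N}
    (hs : ContinuousAt (fun n ↦ (⟨b n, s n⟩ : TotalSpace F V)) n₀)
    (ht : ContinuousAt (fun n ↦ (⟨b n, t n⟩ : TotalSpace F V)) n₀) :
    ContinuousAt (fun n ↦ fiberSeminorm (F := F) f (b n) (s n - t n)) n₀ := by
  have hb : ContinuousAt b n₀ := (FiberBundle.continuous_proj F V).continuousAt.comp hs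
  have hbase : ∀ i ∈ f.fintsupport (b n₀), b n₀ ∈ (trivializationAt F V i).baseSet :=
    fun i hi ↦ hf i ((f.mem_fintsupport_iff _ i).1 hi)
  have hc : ContinuousAt (fun n ↦ ∑ i ∈ f.fintsupport (b n₀), f i (b n) *
      ‖((trivializationAt F V i) ⟨b n, s n⟩).2 - ((trivializationAt F V i) ⟨b n, t n⟩).2‖) n₀ := by
    refine tendsto_finsetSum _ fun i hi ↦ ?_
    have he : ∀ v : V (b n₀), ContinuousAt (trivializationAt F V i) ⟨b n₀, v⟩ := fun v ↦
      (trivializationAt F V i).continuousAt ((trivializationAt F V i).mem_source.2 (hbase i hi))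
    have h1 : ContinuousAt (fun n ↦ f i (b n)) n₀ :=
      (f i).contMDiff.continuous.continuousAt.comp hb
    have h2 := (ContinuousAt.comp (f := fun n ↦ (⟨b n, s n⟩ : TotalSpace F V)) (he _) hs).snd
    have h3 := (ContinuousAt.comp (f := fun n ↦ (⟨b n, t n⟩ : TotalSpace F V)) (he _) ht).snd
    exact h1.mul (h2.sub h3).norm
  refine hc.congr ?_
  have hev : ∀ᶠ n in 𝓝 n₀, ∀ i ∈ f.fintsupport (b n₀),
      b n ∈ (trivializationAt F V i).baseSet :=
    (Filter.eventually_all_finset _).2 fun i hi ↦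
      hb.eventually ((trivializationAt F V i).open_baseSet.mem_nhds (hbase i hi))
  filter_upwards [hev, hb.eventually (f.eventually_finsupport_subset _)] with n hn hns
  rw [fiberSeminorm_apply hns]
  refine Finset.sum_congr rfl fun i hi ↦ ?_
  rw [map_sub, Trivialization.coe_linearMapAt_of_mem _ (hn i hi)]

/-- A continuous family of injective linear maps over a smooth map can be replaced by a smooth
one. -/
theorem IsContinuousInjectiveOver.exists_contMDiff [FiniteDimensional ℝ E] [IsManifold I ∞ M]
    [T2Space M] [SigmaCompactSpace M] [FiniteDimensional ℝ F] [ContMDiffVectorBundle ∞ F V I]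
    {ψ : M → M} (hψ : ContMDiff I I ∞ ψ) {τ : ∀ x, V x →ₗ[ℝ] V (ψ x)}
    (hτ : IsContinuousInjectiveOver F τ) :
    ∃ σ : ∀ x, V x →ₗ[ℝ] V (ψ x), (∀ x, Function.Injective (σ x)) ∧
      ContMDiff (I.prod 𝓘(ℝ, F)) (I.prod 𝓘(ℝ, F)) ∞
        (fun p : TotalSpace F V ↦ (⟨ψ p.proj, σ p.proj p.2⟩ : TotalSpace F V)) := by
  let e : M → Trivialization F (π F V) := fun i ↦ trivializationAt F V i
  have he : ∀ i, i ∈ (e i).baseSet := fun i ↦ FiberBundle.mem_baseSet_trivializationAt' i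
  obtain ⟨g, hg⟩ := SmoothPartitionOfUnity.exists_isSubordinate I isClosed_univ
    (fun i : M ↦ (trivializationAt F V i).baseSet)
    (fun i ↦ (trivializationAt F V i).open_baseSet)
    (fun x _ ↦ mem_iUnion.2 ⟨x, FiberBundle.mem_baseSet_trivializationAt' x⟩)
  -- `c i` is the matrix of `τ` at the single point `i`; `L i` extends it with constant matrix, so
  -- it is smooth near `i` and agrees with `τ` at `i`.
  let c : M → F →L[ℝ] F := fun i ↦ LinearMap.toContinuousLinearMap
    ((trivializationAt F V (ψ i)).linearMapAt ℝ (ψ i) ∘ₗ τ i ∘ₗ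
      (trivializationAt F V i).symmₗ ℝ i)
  let L : M → ∀ x, V x →ₗ[ℝ] V (ψ x) := fun i x ↦
    (trivializationAt F V (ψ i)).symmₗ ℝ (ψ x) ∘ₗ (c i : F →ₗ[ℝ] F) ∘ₗ
      (trivializationAt F V i).linearMapAt ℝ x
  have hLL : ∀ i (v : V i), L i i v = τ i v := by
    intro i v
    simp only [L, c, LinearMap.comp_apply, ContinuousLinearMap.coe_coe,
      LinearMap.coe_toContinuousLinearMap']
    rw [Trivialization.symmₗ_linearMapAt _ (he i), Trivialization.symmₗ_linearMapAt _ (he (ψ i))]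
  have hLc : ∀ i (v : V i), ContinuousAt (fun p : TotalSpace F V ↦
      (⟨ψ p.proj, L i p.proj p.2⟩ : TotalSpace F V)) ⟨i, v⟩ := by
    intro i v
    have hs : (⟨i, v⟩ : TotalSpace F V) ∈ (e i).source := (e i).mem_source.2 (he i)
    have h1 : ContinuousAt (fun p : TotalSpace F V ↦ (ψ p.proj, c i ((e i) p).2)) ⟨i, v⟩ :=
      (hψ.continuous.comp (FiberBundle.continuous_proj F V)).continuousAt.prodMk
        ((c i).continuous.continuousAt.comp ((e i).continuousAt hs).snd)
    refine (ContinuousAt.comp (f := fun p : TotalSpace F V ↦ (ψ p.proj, c i ((e i) p).2))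
      ((e (ψ i)).continuousAt_mk_symmₗ (he (ψ i)) _) h1).congr ?_
    filter_upwards [(e i).open_source.mem_nhds hs] with p hp
    have : ((e i) p).2 = (e i).linearMapAt ℝ p.proj p.2 := by
      rw [Trivialization.coe_linearMapAt_of_mem _ ((e i).mem_source.1 hp)]
    simp only [Function.comp_apply, this]
    rfl
  let near : M → M → Prop := fun i x ↦ ∀ v : V x, v ≠ 0 →
    fiberSeminorm (F := F) g (ψ x) (L i x v - τ x v) < fiberSeminorm (F := F) g (ψ x) (τ x v)
  have hnear : ∀ i, ∀ᶠ x in 𝓝 i, near i x := by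
    intro i
    have := eventually_forall_ne_zero (F := F) (V := V) (x₀ := i) (y₀ := ())
      (Q := fun p _ ↦ fiberSeminorm (F := F) g (ψ p.proj) (L i p.proj p.2 - τ p.proj p.2) <
        fiberSeminorm (F := F) g (ψ p.proj) (τ p.proj p.2)) ?_ ?_
    · rw [nhds_prod_eq] at this
      exact this.curry.mono fun x hx ↦ hx.self_of_nhds
    · intro x v _ a ha hlt
      simp only [map_smul, ← smul_sub, map_smul_eq_mul] at hlt
      exact lt_of_mul_lt_mul_left hlt (norm_nonneg a)
    · intro v hv
      refine continuousAt_fst.eventually (p := fun p : TotalSpace F V ↦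
        fiberSeminorm (F := F) g (ψ p.proj) (L i p.proj p.2 - τ p.proj p.2) <
          fiberSeminorm (F := F) g (ψ p.proj) (τ p.proj p.2)) ?_
      have h0 : Continuous fun p : TotalSpace F V ↦ (⟨ψ p.proj, 0⟩ : TotalSpace F V) :=
        (contMDiff_zeroSection (n := ∞) (IB := I) ℝ V).continuous.comp
          (hψ.continuous.comp (FiberBundle.continuous_proj F V))
      have h1 := continuousAt_fiberSeminorm_sub hg hτ.2.continuousAt
        (h0.continuousAt (x := ⟨i, v⟩))
      simp only [sub_zero] at h1
      refine (continuousAt_fiberSeminorm_sub hg (hLc i v) hτ.2.continuousAt).eventually_lt h1 ?_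
      simp only [hLL, sub_self, map_zero]
      exact fiberSeminorm_pos hg ((map_ne_zero_iff _ (hτ.1 i)).2 hv)
  have hU : ∀ i, ∃ U, (∀ x ∈ U, near i x ∧ x ∈ (e i).baseSet ∧ ψ x ∈ (e (ψ i)).baseSet) ∧
      IsOpen U ∧ i ∈ U := fun i ↦ eventually_nhds_iff.1 ((hnear i).and
    (((e i).open_baseSet.eventually_mem (he i)).and
      (hψ.continuous.continuousAt.eventually ((e (ψ i)).open_baseSet.mem_nhds (he (ψ i))))))
  choose U hUnear hUo hUi using hU
  obtain ⟨f, hf⟩ := SmoothPartitionOfUnity.exists_isSubordinate I isClosed_univ U hUo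
    (fun x _ ↦ mem_iUnion.2 ⟨x, hUi x⟩)
  refine ⟨fun x ↦ linearPatch f ψ c x (ψ x), fun x ↦ (injective_iff_map_eq_zero _).2 fun v hv ↦ ?_,
    fun p ↦ contMDiffAt_linearPatch contMDiffAt_id
      (hψ.contMDiffAt.comp p (contMDiffAt_proj V)) fun i hi ↦ (hUnear i _ (hf i hi)).2⟩
  by_contra hv0
  -- Balls of a seminorm are convex, so the average stays within this one; its radius is the size of
  -- its centre, which excludes `0`.
  have hmem : (linearPatch f ψ c x (ψ x) : V x →ₗ[ℝ] V (ψ x)) v ∈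
      (fiberSeminorm (F := F) g (ψ x)).ball (τ x v)
        (fiberSeminorm (F := F) g (ψ x) (τ x v)) := by
    rw [linearPatch_apply subset_rfl]
    refine (Seminorm.convex_ball _ _ _).sum_mem (fun i _ ↦ f.nonneg i x)
      (f.sum_finsupport x (mem_univ x)) fun i hi ↦ ?_
    rw [Seminorm.mem_ball]
    exact (hUnear i x (hf i ((f.mem_fintsupport_iff x i).1
      (f.finsupport_subset_fintsupport x hi)))).1 v hv0
  rw [hv, Seminorm.mem_ball, zero_sub, map_neg_eq_map] at hmem
  exact lt_irrefl _ hmem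

/-! ### Smoothness of the inverse and construction of the lift -/

theorem contMDiffAt_clm_of_forall_apply [FiniteDimensional ℝ F] {n : ℕ∞ω} {B : M → F →L[ℝ] F}
    {x₀ : M} (h : ∀ u, ContMDiffAt I 𝓘(ℝ, F) n (fun x ↦ B x u) x₀) :
    ContMDiffAt I 𝓘(ℝ, F →L[ℝ] F) n B x₀ := by
  let ι := Module.finBasis ℝ F
  have hB : B = fun x ↦ ∑ k, ContinuousLinearMap.smulRightL ℝ F F
      (LinearMap.toContinuousLinearMap (ι.coord k)) (B x (ι k)) := by
    ext x u
    conv_lhs => rw [← ι.sum_repr u]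
    rw [map_sum]
    simp
  rw [hB]
  exact ContMDiffAt.sum fun k _ ↦ (ContinuousLinearMap.contMDiff _).contMDiffAt.comp x₀ (h (ι k))

variable (F) in
theorem finrank_fiber (x : M) : Module.finrank ℝ (V x) = Module.finrank ℝ F :=
  ((trivializationAt F V x).linearEquivAt ℝ x
    (FiberBundle.mem_baseSet_trivializationAt' x)).finrank_eq

variable (F) in
theorem finiteDimensional_fiber [FiniteDimensional ℝ F] (x : M) : FiniteDimensional ℝ (V x) :=
  ((trivializationAt F V x).linearEquivAt ℝ x
    (FiberBundle.mem_baseSet_trivializationAt' x)).symm.finiteDimensional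

/-- A right inverse of a smooth map of total spaces which is fibrewise linear and injective over a
diffeomorphism of the base is smooth. -/
theorem contMDiff_of_rightInverse [FiniteDimensional ℝ F] [ContMDiffVectorBundle ∞ F V I]
    (ψ : M ≃ₘ^∞⟮I, I⟯ M) {σ : ∀ x, V x →ₗ[ℝ] V (ψ x)} (hinj : ∀ x, Function.Injective (σ x))
    (hσ : ContMDiff (I.prod 𝓘(ℝ, F)) (I.prod 𝓘(ℝ, F)) ∞
      (fun p : TotalSpace F V ↦ (⟨ψ p.proj, σ p.proj p.2⟩ : TotalSpace F V)))
    {R : TotalSpace F V → TotalSpace F V}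
    (hR : ∀ q, (⟨ψ (R q).proj, σ (R q).proj (R q).2⟩ : TotalSpace F V) = q) :
    ContMDiff (I.prod 𝓘(ℝ, F)) (I.prod 𝓘(ℝ, F)) ∞ R := by
  intro q₀
  have hproj : ∀ q, (R q).proj = ψ.symm q.proj := fun q ↦ by
    conv_rhs => rw [← hR q]
    exact (ψ.symm_apply_apply _).symm
  set x₀ := (R q₀).proj with hx₀
  set e := trivializationAt F V x₀
  set e' := trivializationAt F V (ψ x₀)
  have he : x₀ ∈ e.baseSet := FiberBundle.mem_baseSet_trivializationAt' _
  have he' : ψ x₀ ∈ e'.baseSet := FiberBundle.mem_baseSet_trivializationAt' _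
  have hψx₀ : ψ x₀ = q₀.proj := by rw [hx₀, hproj, ψ.apply_symm_apply]
  have hbase : ContMDiff (I.prod 𝓘(ℝ, F)) I ∞ (fun q ↦ (R q).proj) := by
    simp only [hproj]
    exact ψ.symm.contMDiff.comp (contMDiff_proj V)
  -- `B x` is the matrix of `σ x`. The fibre coordinate of `R q` is its inverse applied to that of
  -- `q`, and operator inversion is smooth at invertible operators.
  let B : M → F →L[ℝ] F := fun x ↦ LinearMap.toContinuousLinearMap
    (e'.linearMapAt ℝ (ψ x) ∘ₗ σ x ∘ₗ e.symmₗ ℝ x)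
  have hnear : ∀ᶠ x in 𝓝 x₀, x ∈ e.baseSet ∧ ψ x ∈ e'.baseSet :=
    (e.open_baseSet.eventually_mem he).and
      (ψ.continuous.continuousAt.eventually (e'.open_baseSet.mem_nhds he'))
  have hB : ContMDiffAt I 𝓘(ℝ, F →L[ℝ] F) ∞ B x₀ := by
    refine contMDiffAt_clm_of_forall_apply fun u ↦ ?_
    have h1 : ContMDiffAt I (I.prod 𝓘(ℝ, F)) ∞
        (fun x ↦ (⟨x, e.symmₗ ℝ x u⟩ : TotalSpace F V)) x₀ := by
      refine (e.contMDiffAt_section_iff he).2 (contMDiffAt_const (c := u) |>.congr_of_eventuallyEq ?_)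
      filter_upwards [e.open_baseSet.mem_nhds he] with x hx
      have := e.linearMapAt_symmₗ (R := ℝ) hx u
      rwa [e.coe_linearMapAt_of_mem hx] at this
    have h2 := hσ.contMDiffAt.comp x₀ h1
    refine ((e'.contMDiffAt_iff (e'.mem_source.2 he')).1 h2).2.congr_of_eventuallyEq ?_
    filter_upwards [hnear] with x hx
    simp only [B, LinearMap.coe_toContinuousLinearMap', LinearMap.comp_apply,
      e'.coe_linearMapAt_of_mem hx.2, Function.comp_apply]
  have hBinv : ∀ x, x ∈ e.baseSet → ψ x ∈ e'.baseSet → (B x).IsInvertible := by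
    intro x hx hx'
    have hBinj : Function.Injective (B x : F →ₗ[ℝ] F) :=
      (Function.LeftInverse.injective (e'.symmₗ_linearMapAt (R := ℝ) hx')).comp
        ((hinj x).comp (Function.LeftInverse.injective (e.linearMapAt_symmₗ (R := ℝ) hx)))
    exact ⟨(LinearEquiv.ofInjectiveEndo _ hBinj).toContinuousLinearEquiv, by ext; rfl⟩
  refine (e.contMDiffAt_iff (e.mem_source.2 he)).2 ⟨hbase.contMDiffAt, ?_⟩
  have hq₀ : q₀ ∈ e'.source := e'.mem_source.2 (hψx₀ ▸ he')
  have h1 : ContMDiffAt (I.prod 𝓘(ℝ, F)) 𝓘(ℝ, F →L[ℝ] F) ∞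
      (fun q ↦ (B (R q).proj).inverse) q₀ := by
    have h2 : ContMDiffAt (I.prod 𝓘(ℝ, F)) 𝓘(ℝ, F →L[ℝ] F) ∞ (fun q ↦ B (R q).proj) q₀ :=
      ContMDiffAt.comp (g := B) q₀ hB hbase.contMDiffAt
    have h4 : ContMDiffAt 𝓘(ℝ, F →L[ℝ] F) 𝓘(ℝ, F →L[ℝ] F) ∞
        (ContinuousLinearMap.inverse : (F →L[ℝ] F) → F →L[ℝ] F) (B (R q₀).proj) :=
      (hBinv x₀ he he').contDiffAt_map_inverse.contMDiffAt
    exact h4.comp q₀ h2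
  have h3 : ContMDiffAt (I.prod 𝓘(ℝ, F)) 𝓘(ℝ, F) ∞ (fun q ↦ (e' q).2) q₀ :=
    ((e'.contMDiffAt_iff (f := id) hq₀).1 contMDiffAt_id).2
  refine (h1.clm_apply h3).congr_of_eventuallyEq ?_
  filter_upwards [hbase.continuous.continuousAt.eventually hnear] with q hq
  refine ((hBinv _ hq.1 hq.2).inverse_apply_eq.2 ?_).symm
  conv_lhs => rw [← hR q]
  simp only [B, LinearMap.coe_toContinuousLinearMap', LinearMap.comp_apply,
    e'.coe_linearMapAt_of_mem hq.2]
  have : e.symmₗ ℝ (R q).proj (e (R q)).2 = (R q).2 := by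
    have := e.symmₗ_linearMapAt (R := ℝ) hq.1 (R q).2
    rwa [e.coe_linearMapAt_of_mem hq.1] at this
  rw [this]

variable [FiniteDimensional ℝ F] [ContMDiffVectorBundle ∞ F V I]

/-- A smooth family of injective linear maps `V x → V (ψ x)` over a diffeomorphism `ψ` yields an
automorphism of `V` lifting `ψ`. -/
theorem canBeLifted_of_contMDiff (ψ : M ≃ₘ^∞⟮I, I⟯ M) {σ : ∀ x, V x →ₗ[ℝ] V (ψ x)}
    (hinj : ∀ x, Function.Injective (σ x))
    (hσ : ContMDiff (I.prod 𝓘(ℝ, F)) (I.prod 𝓘(ℝ, F)) ∞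
      (fun p : TotalSpace F V ↦ (⟨ψ p.proj, σ p.proj p.2⟩ : TotalSpace F V))) :
    CanBeLifted I F V ψ := by
  have hfd := finiteDimensional_fiber F (V := V)
  let L : ∀ x, V x ≃ₗ[ℝ] V (ψ x) := fun x ↦ LinearEquiv.ofInjectiveOfFinrankEq (σ x) (hinj x)
    ((finrank_fiber F x).trans (finrank_fiber F (ψ x)).symm)
  have hbij : Function.Bijective
      fun p : TotalSpace F V ↦ (⟨ψ p.proj, σ p.proj p.2⟩ : TotalSpace F V) := by
    constructor
    · rintro ⟨x, v⟩ ⟨y, w⟩ h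
      obtain rfl : x = y := ψ.injective (congrArg TotalSpace.proj h)
      exact congrArg (TotalSpace.mk x) (hinj x (TotalSpace.mk_inj.1 h))
    · rintro ⟨y, w⟩
      obtain ⟨x, rfl⟩ := ψ.surjective y
      obtain ⟨v, rfl⟩ := (L x).surjective w
      exact ⟨⟨x, v⟩, rfl⟩
  let e := Equiv.ofBijective _ hbij
  let Φ : VectorBundleAut I F V :=
    { toDiffeomorph :=
        { toEquiv := e
          contMDiff_toFun := hσ
          contMDiff_invFun := contMDiff_of_rightInverse ψ hinj hσ e.apply_symm_apply }
      exists_linearEquiv := fun x ↦ ⟨ψ x, L x, fun v ↦ rfl⟩ }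
  exact ⟨Φ, Diffeomorph.ext fun x ↦ rfl⟩

/-- Liftability of a diffeomorphism to a vector bundle is invariant under homotopy. -/
theorem CanBeLifted.of_C0Homotopic [FiniteDimensional ℝ E] [IsManifold I ∞ M]
    [T2Space M] [SigmaCompactSpace M] {φ ψ : M ≃ₘ^∞⟮I, I⟯ M} (h : φ.C0Homotopic ψ)
    (hφ : CanBeLifted I F V φ) : CanBeLifted I F V ψ := by
  obtain ⟨Φ, rfl⟩ := hφ
  have hlin : ∀ x, ∃ L : V x ≃ₗ[ℝ] V (Φ.hV x), ∀ v, Φ.toDiffeomorph ⟨x, v⟩ = ⟨Φ.hV x, L v⟩ := by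
    intro x
    obtain ⟨y, L, hL⟩ := Φ.exists_linearEquiv x
    obtain rfl : y = Φ.hV x := by
      have := Φ.proj_toDiffeomorph ⟨x, 0⟩
      rwa [hL] at this
    exact ⟨L, hL⟩
  choose L hL using hlin
  have hτ : IsContinuousInjectiveOver F (V := V)
      (b := (⟨Φ.hV, Φ.hV.continuous⟩ : C(M, M))) (fun x ↦ (L x : V x →ₗ[ℝ] V (Φ.hV x))) :=
    ⟨fun x ↦ (L x).injective, Φ.toDiffeomorph.continuous.congr fun p ↦ hL p.proj p.2⟩
  obtain ⟨H⟩ := h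
  obtain ⟨τ, hτ'⟩ := IsContinuousInjectiveOver.of_homotopy (I := I) H hτ
  obtain ⟨σ, hinj, hσ⟩ := hτ'.exists_contMDiff (I := I) ψ.contMDiff
  exact canBeLifted_of_contMDiff ψ hinj hσ

end LiftingDiffeomorphisms

theorem mainTheorem2
    {E : Type*} [NormedAddCommGroup E] [NormedSpace ℝ E] [FiniteDimensional ℝ E]
    {H : Type*} [TopologicalSpace H] (I : ModelWithCorners ℝ E H)
    {M : Type*} [TopologicalSpace M] [ChartedSpace H M] [IsManifold I ∞ M]
    [BoundarylessManifold I M] [T2Space M] [SecondCountableTopology M] [ConnectedSpace M]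
    (F : Type*) [NormedAddCommGroup F] [NormedSpace ℝ F] [FiniteDimensional ℝ F]
    (V : M → Type*) [∀ x, AddCommGroup (V x)] [∀ x, Module ℝ (V x)]
    [∀ x, TopologicalSpace (V x)] [TopologicalSpace (TotalSpace F V)] [FiberBundle F V]
    [VectorBundle ℝ F V] [ContMDiffVectorBundle ∞ F V I] :
    (∀ φ ψ : M ≃ₘ^∞⟮I, I⟯ M, φ.C0Homotopic ψ →
      (CanBeLifted I F V φ ↔ CanBeLifted I F V ψ)) ∧
    ((∀ φ : M ≃ₘ^∞⟮I, I⟯ M, ∃ ψ : M ≃ₘ^∞⟮I, I⟯ M, φ.C0Homotopic ψ ∧ CanBeLifted I F V ψ) →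
      Function.Surjective
        (VectorBundleAut.hV : VectorBundleAut I F V → (M ≃ₘ^∞⟮I, I⟯ M))) := by
  -- Local compactness and second countability give the σ-compactness needed for partitions of
  -- unity.
  have : LocallyCompactSpace H := I.locallyCompactSpace
  have : LocallyCompactSpace M := ChartedSpace.locallyCompactSpace H M
  have key : ∀ φ ψ : M ≃ₘ^∞⟮I, I⟯ M, φ.C0Homotopic ψ →
      (CanBeLifted I F V φ ↔ CanBeLifted I F V ψ) := fun φ ψ h ↦
    ⟨CanBeLifted.of_C0Homotopic h, CanBeLifted.of_C0Homotopic (ContinuousMap.Homotopic.symm h)⟩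
  refine ⟨key, fun h φ ↦ ?_⟩
  obtain ⟨ψ, hφψ, hψ⟩ := h φ
  exact (key φ ψ hφψ).2 hψ
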